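/- **Theorem 4.5.** For $i\in\{1,\dots,5\}$, a finite group $G$ of order $n$ and a real $c>0$, let $P_i(G,c)$ be the following statement. (i) For every subset $A\subseteq G$, the directed Cayley graph with generators in $A$ is $c$-quasirandom. Here this graph is regarded as the bipartite graph whose vertex classes are two copies of $G$, with $x$ joined to $y$ if $ax=y$ for some $a\in A$; and a bipartite graph with vertex classes $X,Y$ and $p|X||Y|$ edges is $c$-quasirandom if $\sum_{x,x'\in X}|N_x\cap N_{x'}|^2\le (p^4+c)|X|^2|Y|^2$, where $N_x\subseteq Y$ is the neighbourhood of $x$. (ii) For every subset $A\subseteq G$ and every function $f:G\to\mathbb C$ with $\sum_{g}f(g)=0$, one has $\|A*f\|\le c\,n^{1/2}|A|^{1/2}\|f\|$. Here $A$ also denotes the characteristic function of $A$, $(A*f)(y)=\sum_{uv=y}A(u)f(v)$ and $\|f\|=(\sum_g|f(g)|^2)^{1/2}$. (iii) Every function $f$ from $G$ to the closed unit disc in $\mathbb C$ with $\sum_g f(g)=0$ is $c$-quasirandom, that is, $\sum_{y\in G}\bigl|\sum_{x\in G}f(x)\overline{f(yx)}\bigr|^2\le c\,n^3$. (iv) For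 every function $f$ from $G$ to the closed unit disc in $\mathbb C$ with $\sum_g f(g)=0$, the function $F(x,y)=f(xy^{-1})$ is $c$-quasirandom on $G\times G$, that is, $\sum_{x,x'}\sum_{y,y'}F(x,y)\overline{F(x,y')}\,\overline{F(x',y)}F(x',y')\le c\,n^4$. (v) Every non-trivial finite-dimensional complex representation of $G$ (one in which some element of $G$ does not act as the identity) has dimension at least $c^{-1}$. These statements are polynomially equivalent: for all $i,j\in\{1,\dots,5\}$ there are absolute constants $K,\delta>0$ such that, for every finite group $G$ and every $c>0$, $P_i(G,c)$ implies $P_j(G,Kc^{\delta})$. Moreover (iii) and (iv) are equivalent with the same constant, for every finite group $G$. -/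

import Mathlib

universe u

/-- A finite bipartite graph with vertex classes `X` and `Y` is given by its adjacency relation
`E : X → Y → Prop`; `bipNeighbors E x` is the neighbourhood `N_x ⊆ Y` of a vertex `x ∈ X`. -/
noncomputable def bipNeighbors {X Y : Type*} [Fintype Y] (E : X → Y → Prop) (x : X) : Finset Y :=
  open scoped Classical in Finset.univ.filter (fun y => E x y)

/-- The density `p` of a bipartite graph: it has `p |X| |Y|` edges. -/
noncomputable def bipDensity {X Y : Type*} [Fintype X] [Fintype Y] (E : X → Y → Prop) : ℝ :=
  (∑ x : X, ((bipNeighbors E x).card : ℝ)) / ((Fintype.card X : ℝ) * (Fintype.card Y : ℝ))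

/-- A bipartite graph of density `p` is `c`-quasirandom if
`∑_{x, x' ∈ X} |N_x ∩ N_{x'}|² ≤ (p⁴ + c) |X|² |Y|²`. -/
def IsQuasirandomBipGraph {X Y : Type*} [Fintype X] [Fintype Y]
    (E : X → Y → Prop) (c : ℝ) : Prop :=
  open scoped Classical in
  ∑ x : X, ∑ x' : X, ((bipNeighbors E x ∩ bipNeighbors E x').card : ℝ) ^ 2 ≤
    (bipDensity E ^ 4 + c) * (Fintype.card X : ℝ) ^ 2 * (Fintype.card Y : ℝ) ^ 2

/-- The directed Cayley graph with generators in `A`, as a bipartite graph on two copies of `G`: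
`x` is joined to `y` if `a x = y` for some `a ∈ A`. -/
def cayleyAdj {G : Type*} [Group G] (A : Finset G) (x y : G) : Prop :=
  ∃ a ∈ A, a * x = y

/-- The sum `∑_{x,x'} ∑_{y,y'} F(x,y) conj F(x,y') conj F(x',y) F(x',y')`. -/
noncomputable def rectangleSum {X Y : Type*} [Fintype X] [Fintype Y] (F : X → Y → ℂ) : ℂ :=
  ∑ x : X, ∑ x' : X, ∑ y : Y, ∑ y' : Y,
    F x y * (starRingEnd ℂ) (F x y') * (starRingEnd ℂ) (F x' y) * F x' y'

theorem rectangleSum_im {X Y : Type*} [Fintype X] [Fintype Y] (F : X → Y → ℂ) :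
    (rectangleSum F).im = 0 := by
  rw [← Complex.conj_eq_iff_im]
  unfold rectangleSum
  simp only [map_sum, map_mul, Complex.conj_conj]
  rw [Finset.sum_comm]
  refine Finset.sum_congr rfl fun x _ => Finset.sum_congr rfl fun x' _ =>
    Finset.sum_congr rfl fun y _ => Finset.sum_congr rfl fun y' _ => by ring

/-- A function `F` on `X × Y` is `c`-quasirandom if
`∑_{x,x'} ∑_{y,y'} F(x,y) conj F(x,y') conj F(x',y) F(x',y') ≤ c |X|² |Y|²`.
The sum is always a real number (see `rectangleSum_im`), so its real part is compared. -/
def IsQuasirandomOnProd {X Y : Type*} [Fintype X] [Fintype Y] (F : X → Y → ℂ) (c : ℝ) : Prop :=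
  (rectangleSum F).re ≤ c * (Fintype.card X : ℝ) ^ 2 * (Fintype.card Y : ℝ) ^ 2

/-- A function `f` on a finite group of order `n` is `c`-quasirandom if
`∑_y |∑_x f(x) conj f(yx)|² ≤ c n³`. -/
def IsQuasirandomFun {G : Type*} [Group G] [Fintype G] (f : G → ℂ) (c : ℝ) : Prop :=
  ∑ y : G, ‖∑ x : G, f x * (starRingEnd ℂ) (f (y * x))‖ ^ 2 ≤ c * (Fintype.card G : ℝ) ^ 3

/-- Convolution on a finite group: `(f * g)(y) = ∑_{uv = y} f(u) g(v)`. -/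
noncomputable def groupConv {G : Type*} [Group G] [Fintype G] (f g : G → ℂ) (y : G) : ℂ :=
  ∑ u : G, f u * g (u⁻¹ * y)

/-- The characteristic function of a set. -/
noncomputable def charFn {G : Type*} (A : Finset G) : G → ℂ :=
  (A : Set G).indicator 1

/-- The Euclidean norm `‖f‖ = (∑_x |f(x)|²)^{1/2}`. -/
noncomputable def l2norm {G : Type*} [Fintype G] (f : G → ℂ) : ℝ :=
  ‖(WithLp.toLp 2 f : EuclideanSpace ℂ G)‖

/-- A property of finite groups that involves a real constant. -/
abbrev GroupProperty : Type (u + 1) :=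
  ∀ (G : Type u) [Group G] [Fintype G], ℝ → Prop

/-- All directed Cayley graphs of `G` are `c`-quasirandom. -/
def CayleyQuasirandom : GroupProperty.{u} := fun G _ _ c =>
  ∀ A : Finset G, IsQuasirandomBipGraph (cayleyAdj A) c

/-- `‖A * f‖ ≤ c n^{1/2} |A|^{1/2} ‖f‖` for all `A ⊆ G` and all `f` that sum to zero. -/
def ConvolutionBound : GroupProperty.{u} := fun G _ _ c =>
  ∀ (A : Finset G) (f : G → ℂ), ∑ x : G, f x = 0 →
    l2norm (groupConv (charFn A) f) ≤
      c * Real.sqrt (Fintype.card G) * Real.sqrt A.card * l2norm f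

/-- All functions from `G` to the closed unit disc that sum to zero are `c`-quasirandom. -/
def FunctionsQuasirandom : GroupProperty.{u} := fun G _ _ c =>
  ∀ f : G → ℂ, (∀ x, ‖f x‖ ≤ 1) → ∑ x : G, f x = 0 → IsQuasirandomFun f c

/-- For all functions `f` from `G` to the closed unit disc that sum to zero, the function
`F(x, y) = f(x y⁻¹)` is `c`-quasirandom on `G × G`. -/
def ProductFunctionsQuasirandom : GroupProperty.{u} := fun G _ _ c =>
  ∀ f : G → ℂ, (∀ x, ‖f x‖ ≤ 1) → ∑ x : G, f x = 0 →
    IsQuasirandomOnProd (fun x y : G => f (x * y⁻¹)) c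

/-- All non-trivial (finite-dimensional, complex) representations of `G` have dimension at least
`c⁻¹`. A representation is non-trivial if some element of `G` does not act as the identity. -/
def RepresentationsLarge : GroupProperty.{u} := fun G _ _ c =>
  ∀ (V : Type u) [AddCommGroup V] [Module ℂ V] [FiniteDimensional ℂ V]
    (ρ : Representation ℂ G V), ¬ ρ.IsTrivial →
      c⁻¹ ≤ (Module.finrank ℂ V : ℝ)

/-- `P` implies `Q` polynomially: there are absolute constants `K, δ > 0` such that, for every
finite group `G` and every `c > 0`, if `P` holds for `G` with constant `c` then `Q` holds for `G`
with constant `K c^δ`. -/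
def PolyImplies (P Q : GroupProperty.{u}) : Prop :=
  ∃ K δ : ℝ, 0 < K ∧ 0 < δ ∧
    ∀ (G : Type u) [Group G] [Fintype G] (c : ℝ), 0 < c → P G c → Q G (K * c ^ δ)

/-! Property (v) is the hub: (iii) and (iv) are the same inequality up to a factor `n`, (ii) and
(iii) both give (i), (i) gives (v), and (v) gives (ii) and (iii). Representations are first traded
for spaces `W` of sum-zero functions stable under right translation (`representationsLarge_iff`),
and the Cayley graph of `A` for the function `A - p`, with the same constant
(`isQuasirandomBipGraph_cayleyAdj_iff`).

From (v): let `T` be convolution by a sum-zero `f`. The top eigenspace of `T*T` is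
translation-invariant, so the top eigenvalue has multiplicity at least `1/c`. Since the squared
Hilbert–Schmidt norm of `T` is at most `n‖f‖²`, it follows that `‖T‖² ≤ c n ‖f‖²`
(`norm_sq_convMap_le`).

From (i): let `W` have dimension `k` and reproducing kernel `φ`. Then `‖φ‖² = k/n`, and `k/n` also
bounds `φ` pointwise. As `φ` sums to zero, some set `A` has `|∑_A φ| ≥ 1/4` (`exists_le_norm_sum`).
Quasirandomness of `A - p` bounds the same sum by `c^{1/4} k` (`norm_sum_mul_reproducing_le`),
whence `k ≥ c^{-1/4}/4`. -/

/-- Summing over pairs a function of the quotient `x y⁻¹`. -/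
theorem sum_sum_mul_inv {G M : Type*} [Group G] [Fintype G] [NonAssocSemiring M] (h : G → M) :
    ∑ x : G, ∑ y : G, h (x * y⁻¹) = (Fintype.card G : M) * ∑ z : G, h z := by
  rw [Finset.sum_comm]
  have (y : G) : ∑ x : G, h (x * y⁻¹) = ∑ z : G, h z :=
    Fintype.sum_equiv (Equiv.mulRight y⁻¹) _ _ fun _ => rfl
  simp [this]

theorem rectangleSum_eq_rows {X Y : Type*} [Fintype X] [Fintype Y] (F : X → Y → ℂ) :
    rectangleSum F =
      ((∑ x : X, ∑ x' : X, ‖∑ y : Y, F x y * (starRingEnd ℂ) (F x' y)‖ ^ 2 : ℝ) : ℂ) := by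
  unfold rectangleSum
  push_cast
  refine Finset.sum_congr rfl fun x _ => Finset.sum_congr rfl fun x' _ => ?_
  rw [← Complex.mul_conj', map_sum, Finset.sum_mul_sum]
  refine Finset.sum_congr rfl fun y _ => Finset.sum_congr rfl fun y' _ => ?_
  simp only [map_mul, Complex.conj_conj]
  ring

theorem rectangleSum_eq_columns {X Y : Type*} [Fintype X] [Fintype Y] (F : X → Y → ℂ) :
    rectangleSum F =
      ((∑ y : Y, ∑ y' : Y, ‖∑ x : X, F x y * (starRingEnd ℂ) (F x y')‖ ^ 2 : ℝ) : ℂ) := by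
  rw [← rectangleSum_eq_rows fun y x => F x y]
  unfold rectangleSum
  rw [Finset.sum_congr rfl fun x _ => Finset.sum_comm]
  rw [Finset.sum_comm]
  refine Finset.sum_congr rfl fun y _ => ?_
  rw [Finset.sum_congr rfl fun x _ => Finset.sum_comm]
  rw [Finset.sum_comm]
  refine Finset.sum_congr rfl fun y' _ => Finset.sum_congr rfl fun x _ =>
    Finset.sum_congr rfl fun x' _ => by ring

/-! ### Autocorrelations, rectangle sums and Cayley graphs. -/

section Autocorrelation

variable {G : Type*} [Group G] [Fintype G]

theorem rectangleSum_mul_inv_left (f : G → ℂ) :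
    (rectangleSum fun x y : G => f (x * y⁻¹)).re =
      Fintype.card G * ∑ z : G, ‖∑ x : G, f x * (starRingEnd ℂ) (f (z * x))‖ ^ 2 := by
  rw [rectangleSum_eq_rows, Complex.ofReal_re, Finset.sum_comm, ← sum_sum_mul_inv]
  refine Finset.sum_congr rfl fun x _ => Finset.sum_congr rfl fun x' _ => ?_
  congr 2
  refine Fintype.sum_equiv ((Equiv.inv G).trans (Equiv.mulLeft x')) _ _ fun y => ?_
  simp [mul_assoc]

/-- Grouping the rectangle sum by columns instead of rows replaces left shifts by right shifts. In a
non-abelian group the two autocorrelations differ term by term, but their square sums agree. The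
right version is needed for Cayley graphs, where `|Ax ∩ Ax'|` is a right autocorrelation of `A`. -/
theorem rectangleSum_mul_inv_right (f : G → ℂ) :
    (rectangleSum fun x y : G => f (x * y⁻¹)).re =
      Fintype.card G * ∑ z : G, ‖∑ x : G, f x * (starRingEnd ℂ) (f (x * z))‖ ^ 2 := by
  rw [rectangleSum_eq_columns, Complex.ofReal_re, ← sum_sum_mul_inv]
  refine Finset.sum_congr rfl fun y _ => Finset.sum_congr rfl fun y' _ => ?_
  congr 2
  refine Fintype.sum_equiv (Equiv.mulRight y⁻¹) _ _ fun x => ?_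
  simp [mul_assoc]

theorem card_pos_real : (0 : ℝ) < Fintype.card G := Nat.cast_pos.2 Fintype.card_pos

theorem isQuasirandomFun_iff_prod (f : G → ℂ) (c : ℝ) :
    IsQuasirandomFun f c ↔ IsQuasirandomOnProd (fun x y : G => f (x * y⁻¹)) c := by
  have hn := card_pos_real (G := G)
  unfold IsQuasirandomFun IsQuasirandomOnProd
  rw [rectangleSum_mul_inv_left, show c * (Fintype.card G : ℝ) ^ 2 * (Fintype.card G : ℝ) ^ 2 =
    Fintype.card G * (c * (Fintype.card G : ℝ) ^ 3) by ring, mul_le_mul_iff_right₀ hn]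

theorem isQuasirandomFun_iff_right (f : G → ℂ) (c : ℝ) :
    IsQuasirandomFun f c ↔
      ∑ z : G, ‖∑ x : G, f x * (starRingEnd ℂ) (f (x * z))‖ ^ 2 ≤
        c * (Fintype.card G : ℝ) ^ 3 := by
  have hn := card_pos_real (G := G)
  unfold IsQuasirandomFun
  rw [← mul_right_inj' hn.ne' |>.1
    ((rectangleSum_mul_inv_left f).symm.trans (rectangleSum_mul_inv_right f))]

/-- The function `A - p`, where `p` is the density of `A`. -/
noncomputable def balancedFn (A : Finset G) (x : G) : ℂ :=
  charFn A x - (A.card : ℂ) / Fintype.card G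

theorem balancedFn_eq_ofReal {G : Type*} [Fintype G] [DecidableEq G] (A : Finset G) (x : G) :
    balancedFn A x =
      (((if x ∈ A then 1 else 0) - (A.card : ℝ) / Fintype.card G : ℝ) : ℂ) := by
  simp only [balancedFn, charFn, Set.indicator_apply]
  push_cast
  congr 1
  split_ifs <;> simp_all

theorem sum_charFn {G : Type*} [Fintype G] (A : Finset G) : ∑ x : G, charFn A x = A.card := by
  classical
  simp [charFn, Set.indicator_apply]

theorem sum_balancedFn (A : Finset G) : ∑ x : G, balancedFn A x = 0 := by
  have hn : (Fintype.card G : ℂ) ≠ 0 := Nat.cast_ne_zero.2 Fintype.card_ne_zero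
  simp only [balancedFn, Finset.sum_sub_distrib, sum_charFn]
  simp [mul_div_cancel₀ _ hn]

/-- The effect on the right autocorrelation of subtracting the mean. -/
theorem sum_sq_autocorrelation_sub_mean (a : G → ℝ) (p : ℝ)
    (ha : ∑ x : G, a x = p * Fintype.card G) :
    ∑ z : G, (∑ x : G, a x * a (x * z)) ^ 2 =
      ∑ z : G, (∑ x : G, (a x - p) * (a (x * z) - p)) ^ 2 +
        p ^ 4 * (Fintype.card G : ℝ) ^ 3 := by
  have hz (z : G) : ∑ x : G, a (x * z) = p * Fintype.card G := by
    rw [← ha]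
    exact Fintype.sum_equiv (Equiv.mulRight z) _ _ fun _ => rfl
  have hx (x : G) : ∑ z : G, a (x * z) = p * Fintype.card G := by
    rw [← ha]
    exact Fintype.sum_equiv (Equiv.mulLeft x) _ _ fun _ => rfl
  have key (z : G) : ∑ x : G, (a x - p) * (a (x * z) - p) =
      ∑ x : G, a x * a (x * z) - p ^ 2 * Fintype.card G := by
    have : ∀ x : G, (a x - p) * (a (x * z) - p) =
        a x * a (x * z) - p * a x - p * a (x * z) + p ^ 2 := fun x => by ring
    simp only [this, Finset.sum_add_distrib, Finset.sum_sub_distrib, ← Finset.mul_sum, hz, ha]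
    simp only [Finset.sum_const, Finset.card_univ, nsmul_eq_mul]
    ring
  -- The total autocorrelation depends only on the mean, so the cross term in the expanded square is
  -- explicit and the correction is exactly `p⁴n³`.
  have htot : ∑ z : G, ∑ x : G, a x * a (x * z) = p ^ 2 * (Fintype.card G : ℝ) ^ 2 := by
    rw [Finset.sum_comm]
    simp only [← Finset.mul_sum, hx, ← Finset.sum_mul, ha]
    ring
  simp only [key, sub_sq, Finset.sum_add_distrib, Finset.sum_sub_distrib, ← Finset.sum_mul,
    ← Finset.mul_sum, htot]
  simp only [Finset.sum_const, Finset.card_univ, nsmul_eq_mul]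
  ring

theorem cayleyAdj_iff {G : Type*} [Group G] (A : Finset G) (x y : G) : cayleyAdj A x y ↔ y * x⁻¹ ∈ A := by
  constructor
  · rintro ⟨a, ha, rfl⟩
    simpa using ha
  · exact fun h => ⟨_, h, by simp⟩

theorem card_bipNeighbors_cayleyAdj (A : Finset G) (x : G) :
    (bipNeighbors (cayleyAdj A) x).card = A.card := by
  classical
  refine Finset.card_bij' (fun y _ => y * x⁻¹) (fun a _ => a * x) ?_ ?_ ?_ ?_ <;>
    simp [bipNeighbors, cayleyAdj_iff]

theorem bipDensity_cayleyAdj (A : Finset G) :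
    bipDensity (cayleyAdj A) = (A.card : ℝ) / Fintype.card G := by
  have hn := (card_pos_real (G := G)).ne'
  simp only [bipDensity, card_bipNeighbors_cayleyAdj, Finset.sum_const, Finset.card_univ,
    nsmul_eq_mul]
  field_simp

/-- The Cayley graph of `A` is quasirandom if and only if the balanced function of `A` is. -/
theorem isQuasirandomBipGraph_cayleyAdj_iff (A : Finset G) (c : ℝ) :
    IsQuasirandomBipGraph (cayleyAdj A) c ↔ IsQuasirandomFun (balancedFn A) c := by
  classical
  have hn := card_pos_real (G := G)
  set p : ℝ := (A.card : ℝ) / Fintype.card G with hp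
  set a : G → ℝ := fun x => if x ∈ A then 1 else 0 with ha
  have hsum : ∑ x : G, a x = p * Fintype.card G := by
    simp [ha, hp, div_mul_cancel₀ _ hn.ne']
  have hcard (x x' : G) :
      ((bipNeighbors (cayleyAdj A) x ∩ bipNeighbors (cayleyAdj A) x').card : ℝ) =
        ∑ u : G, a u * a (u * (x * x'⁻¹)) := by
    have : ∑ u : G, a u * a (u * (x * x'⁻¹)) = ∑ y : G, a (y * x⁻¹) * a (y * x'⁻¹) := by
      symm
      refine Fintype.sum_equiv (Equiv.mulRight x⁻¹) _ _ fun y => ?_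
      simp [mul_assoc]
    rw [this]
    simp only [bipNeighbors, cayleyAdj_iff, ha, ← Finset.filter_and, ite_and, Finset.card_filter,
      Nat.cast_sum]
    refine Finset.sum_congr rfl fun y _ => ?_
    split_ifs <;> simp
  have hbal (x : G) : balancedFn A x = ((a x - p : ℝ) : ℂ) := balancedFn_eq_ofReal A x
  have hnorm (z : G) : ‖∑ x : G, balancedFn A x * (starRingEnd ℂ) (balancedFn A (x * z))‖ ^ 2 =
      (∑ x : G, (a x - p) * (a (x * z) - p)) ^ 2 := by
    simp only [hbal, Complex.conj_ofReal, ← Complex.ofReal_mul, ← Complex.ofReal_sum,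
      Complex.norm_real, Real.norm_eq_abs, sq_abs]
  rw [isQuasirandomFun_iff_right]
  simp only [hnorm]
  unfold IsQuasirandomBipGraph
  rw [bipDensity_cayleyAdj, ← hp]
  have hlhs : ∑ x : G, ∑ x' : G,
      ((bipNeighbors (cayleyAdj A) x ∩ bipNeighbors (cayleyAdj A) x').card : ℝ) ^ 2 =
      Fintype.card G * (∑ z : G, (∑ x : G, (a x - p) * (a (x * z) - p)) ^ 2 +
        p ^ 4 * (Fintype.card G : ℝ) ^ 3) := by
    rw [← sum_sq_autocorrelation_sub_mean a p hsum,
      ← sum_sum_mul_inv fun z => (∑ x : G, a x * a (x * z)) ^ 2]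
    simp only [hcard]
  have hrhs : (p ^ 4 + c) * (Fintype.card G : ℝ) ^ 2 * (Fintype.card G : ℝ) ^ 2 =
      Fintype.card G * (c * (Fintype.card G : ℝ) ^ 3 + p ^ 4 * (Fintype.card G : ℝ) ^ 3) := by
    ring
  rw [hrhs]
  refine Iff.trans ?_ ((mul_le_mul_iff_right₀ hn).trans
    (add_le_add_iff_right (p ^ 4 * (Fintype.card G : ℝ) ^ 3)))
  rw [← hlhs]

end Autocorrelation

/-! ### Representations and translation-invariant function spaces. -/

section Translation

variable {G : Type*} [Group G] [Fintype G]

/-- Right translation `(R_g h)(x) = h(xg)` of functions on a finite group. -/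
noncomputable def rightTranslate (g : G) : EuclideanSpace ℂ G →ₗ[ℂ] EuclideanSpace ℂ G where
  toFun h := WithLp.toLp 2 fun x => h (x * g)
  map_add' _ _ := rfl
  map_smul' _ _ := rfl

@[simp]
theorem rightTranslate_apply {G : Type*} [Group G] (g : G) (h : EuclideanSpace ℂ G) (x : G) :
    rightTranslate g h x = h (x * g) := rfl

theorem inner_rightTranslate (g : G) (h h' : EuclideanSpace ℂ G) :
    inner ℂ (rightTranslate g h) h' = inner ℂ h (rightTranslate g⁻¹ h') := by
  simp only [PiLp.inner_apply, rightTranslate_apply]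
  exact Fintype.sum_equiv (Equiv.mulRight g) _ _ fun x => by simp

theorem norm_rightTranslate (g : G) (h : EuclideanSpace ℂ G) : ‖rightTranslate g h‖ = ‖h‖ := by
  rw [← sq_eq_sq₀ (norm_nonneg _) (norm_nonneg _)]
  simp only [EuclideanSpace.norm_sq_eq]
  exact Fintype.sum_equiv (Equiv.mulRight g) _ _ fun _ => rfl

/-- A subspace of sum-zero functions that is stable under right translations. -/
structure IsSumZeroInvariant (W : Submodule ℂ (EuclideanSpace ℂ G)) : Prop where
  rightTranslate_mem : ∀ (g : G), ∀ h ∈ W, rightTranslate g h ∈ W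
  sum_eq_zero : ∀ h ∈ W, ∑ x : G, h x = 0

/-- The right regular representation on a stable subspace. -/
noncomputable def rightTranslateRep {W : Submodule ℂ (EuclideanSpace ℂ G)}
    (hW : IsSumZeroInvariant W) : Representation ℂ G W where
  toFun g := (rightTranslate g).restrict (hW.rightTranslate_mem g)
  map_one' := by
    ext h x
    simp
  map_mul' g g' := by
    ext h x
    simp [mul_assoc]

/-- A function fixed by all right translations is constant, and a constant with sum zero vanishes.
-/
theorem not_isTrivial_rightTranslateRep {W : Submodule ℂ (EuclideanSpace ℂ G)}
    (hW : IsSumZeroInvariant W) (hne : W ≠ ⊥) : ¬ (rightTranslateRep hW).IsTrivial := by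
  intro htriv
  obtain ⟨h, hh, h0⟩ := W.exists_mem_ne_zero_of_ne_bot hne
  have hconst (x : G) : h x = h 1 := by
    have := congrArg (fun v : W => (v : EuclideanSpace ℂ G) 1)
      (LinearMap.congr_fun (htriv.out x) ⟨h, hh⟩)
    simpa [rightTranslateRep] using this
  have hn : (Fintype.card G : ℂ) ≠ 0 := Nat.cast_ne_zero.2 Fintype.card_ne_zero
  have hs := hW.sum_eq_zero h hh
  simp only [hconst, Finset.sum_const, Finset.card_univ, nsmul_eq_mul, mul_eq_zero, hn,
    false_or] at hs
  exact h0 (by ext x; simp [hconst x, hs])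

/-- A non-trivial representation of dimension `k` gives a non-zero translation-invariant space of
sum-zero functions, of dimension at most `k`, consisting of centred matrix coefficients. -/
theorem exists_isSumZeroInvariant {V : Type*} [AddCommGroup V] [Module ℂ V]
    [FiniteDimensional ℂ V] (ρ : Representation ℂ G V) (hρ : ¬ ρ.IsTrivial) :
    ∃ W : Submodule ℂ (EuclideanSpace ℂ G), IsSumZeroInvariant W ∧ W ≠ ⊥ ∧
      Module.finrank ℂ W ≤ Module.finrank ℂ V := by
  obtain ⟨g, v, hgv⟩ : ∃ (g : G) (v : V), ρ g v ≠ v := by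
    by_contra! hcon
    exact hρ ⟨fun g => LinearMap.ext (hcon g)⟩
  obtain ⟨l, hl⟩ : ∃ l : Module.Dual ℂ V, l (ρ g v) ≠ l v := by
    by_contra! hcon
    exact hgv (sub_eq_zero.1 ((Module.forall_dual_apply_eq_zero_iff ℂ _).1 fun l => by
      rw [map_sub, hcon l, sub_self]))
  have hn : (Fintype.card G : ℂ) ≠ 0 := Nat.cast_ne_zero.2 Fintype.card_ne_zero
  -- The mean is invariant under `ρ`, so subtracting it gives sum zero without spoiling equivariance
  -- of `L`, and it leaves the difference of the values of `L v` at `g` and `1` unchanged.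
  let m (w : V) : ℂ := (Fintype.card G : ℂ)⁻¹ * ∑ x : G, l (ρ x w)
  let L : V →ₗ[ℂ] EuclideanSpace ℂ G :=
    { toFun := fun w => WithLp.toLp 2 fun x => l (ρ x w) - m w
      map_add' := fun w w' => by
        ext x
        simp only [m, map_add, Finset.sum_add_distrib, PiLp.add_apply]
        ring
      map_smul' := fun r w => by
        ext x
        simp only [m, map_smul, smul_eq_mul, ← Finset.mul_sum, PiLp.smul_apply, RingHom.id_apply]
        ring }
  have hL (w : V) (x : G) : L w x = l (ρ x w) - m w := rfl
  refine ⟨LinearMap.range L, ⟨?_, ?_⟩, ?_, LinearMap.finrank_range_le L⟩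
  · rintro g _ ⟨w, rfl⟩
    refine ⟨ρ g w, ?_⟩
    ext x
    have hm : m (ρ g w) = m w := by
      simp only [m]
      congr 1
      exact Fintype.sum_equiv (Equiv.mulRight g) _ _ fun x => by simp
    simp [hL, hm]
  · rintro _ ⟨w, rfl⟩
    simp only [hL, Finset.sum_sub_distrib, Finset.sum_const, Finset.card_univ, nsmul_eq_mul, m]
    rw [mul_inv_cancel_left₀ hn, sub_self]
  · intro hbot
    have h0 : L v = 0 := by
      rw [← Submodule.mem_bot ℂ, ← hbot]
      exact LinearMap.mem_range_self L v
    have h1 := hL v g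
    have h2 := hL v 1
    rw [h0] at h1 h2
    apply hl
    simp only [PiLp.zero_apply, map_one, Module.End.one_apply] at h1 h2
    rw [← sub_eq_zero.1 h1.symm] at h2
    exact (sub_eq_zero.1 h2.symm).symm

end Translation

/-- The representations of `G` are large exactly if its non-zero translation-invariant spaces of
sum-zero functions are. -/
theorem representationsLarge_iff (G : Type u) [Group G] [Fintype G] (c : ℝ) :
    RepresentationsLarge G c ↔ ∀ W : Submodule ℂ (EuclideanSpace ℂ G), IsSumZeroInvariant W →
      W ≠ ⊥ → c⁻¹ ≤ (Module.finrank ℂ W : ℝ) := by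
  constructor
  · intro h W hW hne
    -- `W` consists of functions on `G`, so it lives in the universe over which
    -- `RepresentationsLarge` quantifies.
    exact h W (rightTranslateRep hW) (not_isTrivial_rightTranslateRep hW hne)
  · intro h V _ _ _ ρ hρ
    obtain ⟨W, hW, hne, hk⟩ := exists_isSumZeroInvariant ρ hρ
    exact (h W hW hne).trans (Nat.cast_le.2 hk)

/-! ### Operator norm of convolution by a sum-zero function. -/

section Convolution

variable {G : Type*} [Group G] [Fintype G]

/-- Convolution by a fixed function, as a linear map. -/
noncomputable def convMap (f : G → ℂ) : EuclideanSpace ℂ G →ₗ[ℂ] EuclideanSpace ℂ G where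
  toFun h := WithLp.toLp 2 (groupConv f h)
  map_add' h h' := by
    ext y
    simp [groupConv, mul_add, Finset.sum_add_distrib]
  map_smul' r h := by
    ext y
    simp [groupConv, Finset.mul_sum, mul_left_comm]

theorem convMap_apply (f : G → ℂ) (h : EuclideanSpace ℂ G) (y : G) :
    convMap f h y = ∑ u : G, f u * h (u⁻¹ * y) := rfl

/-- The adjoint function `x ↦ conj f(x⁻¹)`. -/
noncomputable def adjointFn (f : G → ℂ) (x : G) : ℂ := (starRingEnd ℂ) (f x⁻¹)

theorem sum_adjointFn {f : G → ℂ} (hf : ∑ x : G, f x = 0) : ∑ x : G, adjointFn f x = 0 := by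
  simp only [adjointFn, ← map_sum]
  rw [Fintype.sum_equiv (Equiv.inv G) (fun x => f x⁻¹) f fun _ => rfl, hf, map_zero]

theorem inner_convMap_adjointFn (f : G → ℂ) (h h' : EuclideanSpace ℂ G) :
    inner ℂ (convMap (adjointFn f) h) h' = inner ℂ h (convMap f h') := by
  simp only [PiLp.inner_apply, convMap_apply, RCLike.inner_apply, map_sum, Finset.mul_sum,
    Finset.sum_mul, map_mul, adjointFn, Complex.conj_conj]
  rw [Finset.sum_comm, Finset.sum_comm (s := Finset.univ (α := G))
    (f := fun y u => f u * h' (u⁻¹ * y) * (starRingEnd ℂ) (h y))]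
  refine Fintype.sum_equiv (Equiv.inv G) _ _ fun u => ?_
  refine Fintype.sum_equiv (Equiv.mulLeft u⁻¹) _ _ fun y => ?_
  simp
  ring

theorem sum_convMap (f : G → ℂ) (h : EuclideanSpace ℂ G) :
    ∑ y : G, convMap f h y = (∑ u : G, f u) * ∑ x : G, h x := by
  simp only [convMap_apply]
  rw [Finset.sum_comm, Finset.sum_mul]
  refine Finset.sum_congr rfl fun u _ => ?_
  rw [← Finset.mul_sum]
  congr 1
  exact Fintype.sum_equiv (Equiv.mulLeft u⁻¹) _ _ fun _ => rfl

theorem convMap_rightTranslate (f : G → ℂ) (g : G) (h : EuclideanSpace ℂ G) :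
    convMap f (rightTranslate g h) = rightTranslate g (convMap f h) := by
  ext y
  simp [convMap_apply, mul_assoc]

/-- The Hilbert–Schmidt bound for convolution. -/
theorem sum_norm_sq_convMap_le (f : G → ℂ) {ι : Type*} [Fintype ι]
    {e : ι → EuclideanSpace ℂ G} (he : Orthonormal ℂ e) :
    ∑ i, ‖convMap f (e i)‖ ^ 2 ≤ Fintype.card G * ∑ x : G, ‖f x‖ ^ 2 := by
  simp only [EuclideanSpace.norm_sq_eq]
  rw [Finset.sum_comm, ← nsmul_eq_mul, ← Finset.card_univ]
  refine Finset.sum_le_card_nsmul _ _ _ fun y _ => ?_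
  -- Evaluation of `f * h` at `y` is the inner product with a rearrangement `k` of `conj f`.
  -- Bessel's inequality then bounds the contribution of each `y` by `‖f‖²`.
  let k : EuclideanSpace ℂ G := WithLp.toLp 2 fun x => (starRingEnd ℂ) (f (y * x⁻¹))
  have hk (h : EuclideanSpace ℂ G) : convMap f h y = inner ℂ k h := by
    simp only [convMap_apply, PiLp.inner_apply, RCLike.inner_apply, k, Complex.conj_conj]
    refine Fintype.sum_equiv ((Equiv.inv G).trans (Equiv.mulRight y)) _ _ fun u => ?_
    simp [mul_comm]
  have hnorm : ∑ x : G, ‖f x‖ ^ 2 = ‖k‖ ^ 2 := by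
    rw [EuclideanSpace.norm_sq_eq]
    refine Fintype.sum_equiv ((Equiv.inv G).trans (Equiv.mulRight y)) _ _ fun u => ?_
    simp [k]
  rw [hnorm]
  simp only [hk, norm_inner_symm k]
  exact he.sum_inner_products_le k

/-- If every non-zero translation-invariant space of sum-zero functions has dimension at least
`c⁻¹`, then convolution by a sum-zero function `f` has norm at most `(c n)^{1/2} ‖f‖`. -/
theorem norm_sq_convMap_le {c : ℝ} (hc : 0 < c)
    (hW : ∀ W : Submodule ℂ (EuclideanSpace ℂ G), IsSumZeroInvariant W →
      W ≠ ⊥ → c⁻¹ ≤ (Module.finrank ℂ W : ℝ))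
    {f : G → ℂ} (hf : ∑ x : G, f x = 0) (h : EuclideanSpace ℂ G) :
    ‖convMap f h‖ ^ 2 ≤ c * Fintype.card G * (∑ x : G, ‖f x‖ ^ 2) * ‖h‖ ^ 2 := by
  let M : EuclideanSpace ℂ G →ₗ[ℂ] EuclideanSpace ℂ G := convMap (adjointFn f) ∘ₗ convMap f
  have hM (h : EuclideanSpace ℂ G) : inner ℂ (M h) h = ((‖convMap f h‖ ^ 2 : ℝ) : ℂ) := by
    simp only [M, LinearMap.comp_apply, inner_convMap_adjointFn]
    rw [inner_self_eq_norm_sq_to_K]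
    simp
  have hsymm : M.IsSymmetric := by
    intro h h'
    simp only [M, LinearMap.comp_apply, inner_convMap_adjointFn]
    rw [← inner_conj_symm h, inner_convMap_adjointFn, inner_conj_symm]
  -- Rayleigh quotient of `M = T*T`; in finite dimension its supremum is an eigenvalue, namely the
  -- square of the operator norm of `T`.
  let r (x : {x : EuclideanSpace ℂ G // x ≠ 0}) : ℝ :=
    RCLike.re (inner ℂ (M x) (x : EuclideanSpace ℂ G)) / ‖(x : EuclideanSpace ℂ G)‖ ^ 2
  have hbdd : BddAbove (Set.range r) := by
    refine ⟨‖LinearMap.toContinuousLinearMap M‖, ?_⟩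
    rintro _ ⟨x, rfl⟩
    have hx : 0 < ‖(x : EuclideanSpace ℂ G)‖ := norm_pos_iff.2 x.2
    rw [div_le_iff₀ (by positivity)]
    calc RCLike.re (inner ℂ (M x) (x : EuclideanSpace ℂ G)) ≤ ‖M x‖ * ‖(x : EuclideanSpace ℂ G)‖ :=
          re_inner_le_norm _ _
      _ ≤ (‖LinearMap.toContinuousLinearMap M‖ * ‖(x : EuclideanSpace ℂ G)‖) *
            ‖(x : EuclideanSpace ℂ G)‖ := by
          gcongr
          exact (LinearMap.toContinuousLinearMap M).le_opNorm x
      _ = _ := by ring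
  set lam : ℝ := ⨆ x, r x with hlam
  have hle (h : EuclideanSpace ℂ G) : ‖convMap f h‖ ^ 2 ≤ lam * ‖h‖ ^ 2 := by
    by_cases h0 : h = 0
    · simp [h0]
    have hr : r ⟨h, h0⟩ = ‖convMap f h‖ ^ 2 / ‖h‖ ^ 2 := by
      simp only [r, hM]
      rfl
    rw [← div_le_iff₀ (by positivity), ← hr]
    exact le_ciSup hbdd ⟨h, h0⟩
  have hev : Module.End.HasEigenvalue M ((lam : ℝ) : ℂ) :=
    hsymm.hasEigenvalue_iSup_of_finiteDimensional
  have hF : 0 ≤ ∑ x : G, ‖f x‖ ^ 2 := by positivity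
  refine (hle h).trans ?_
  gcongr
  -- Positivity matters: `M` maps into sum-zero functions, which constrains an eigenspace only when
  -- its eigenvalue is non-zero.
  rcases le_or_gt lam 0 with h0 | hpos
  · exact h0.trans (by positivity)
  set W := Module.End.eigenspace M ((lam : ℝ) : ℂ) with hWdef
  have hinv : IsSumZeroInvariant W := by
    refine ⟨fun g h hh => ?_, fun h hh => ?_⟩
    · rw [hWdef, Module.End.mem_eigenspace_iff] at hh ⊢
      simp only [M, LinearMap.comp_apply, convMap_rightTranslate] at hh ⊢
      rw [hh, map_smul]
    · rw [hWdef, Module.End.mem_eigenspace_iff] at hh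
      have h1 : ∑ x : G, M h x = 0 := by
        simp only [M, LinearMap.comp_apply]
        rw [sum_convMap, sum_adjointFn hf, zero_mul]
      rw [hh] at h1
      simpa [← Finset.mul_sum, hpos.ne'] using h1
  have hdim := hW W hinv hev
  let b := stdOrthonormalBasis ℂ W
  have hb : Orthonormal ℂ fun i => (b i : EuclideanSpace ℂ G) :=
    b.orthonormal.comp_linearIsometry W.subtypeₗᵢ
  have hsum := sum_norm_sq_convMap_le f hb
  -- Every vector of an orthonormal basis of the eigenspace contributes `lam` to the Hilbert–Schmidt
  -- sum, so `dim W * lam ≤ n‖f‖²`.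
  have hterm (i) : ‖convMap f (b i : EuclideanSpace ℂ G)‖ ^ 2 = lam := by
    have h1 := hM (b i : EuclideanSpace ℂ G)
    rw [Module.End.mem_eigenspace_iff.1 (b i).2, inner_smul_left, inner_self_eq_norm_sq_to_K,
      hb.1 i] at h1
    simp only [Complex.conj_ofReal] at h1
    exact Complex.ofReal_injective (by simpa using h1.symm)
  simp only [hterm, Finset.sum_const, Finset.card_univ, Fintype.card_fin, nsmul_eq_mul] at hsum
  calc lam = c * (c⁻¹ * lam) := by rw [mul_inv_cancel_left₀ hc.ne']
    _ ≤ c * (Module.finrank ℂ W * lam) := by gcongr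
    _ ≤ c * (Fintype.card G * ∑ x : G, ‖f x‖ ^ 2) := by gcongr
    _ = _ := by ring

end Convolution

/-! ### Reproducing kernels and their correlation with sets and quasirandom functions. -/

section ReproducingKernel

variable {G : Type*} [Group G] [Fintype G]

/-- The reproducing kernel of a translation-invariant space of sum-zero functions. -/
theorem exists_reproducingKernel {W : Submodule ℂ (EuclideanSpace ℂ G)}
    (hW : IsSumZeroInvariant W) :
    ∃ φ ∈ W, (∀ (x : G), ∀ w ∈ W, inner ℂ (rightTranslate x⁻¹ φ) w = w x) ∧
      ‖φ‖ ^ 2 = Module.finrank ℂ W / Fintype.card G := by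
  classical
  have hn := card_pos_real (G := G)
  -- Projecting the point mass at `1` represents evaluation at `1` on `W`; translates of `φ`
  -- represent evaluation elsewhere.
  let φ : EuclideanSpace ℂ G := W.starProjection (EuclideanSpace.single 1 1)
  have hφ : φ ∈ W := W.starProjection_apply_mem _
  have hrep (x : G) (w : EuclideanSpace ℂ G) (hw : w ∈ W) :
      inner ℂ (rightTranslate x⁻¹ φ) w = w x := by
    have hx := hW.rightTranslate_mem x w hw
    rw [inner_rightTranslate, inv_inv, Submodule.inner_starProjection_left_eq_right,
      Submodule.starProjection_eq_self_iff.2 hx, EuclideanSpace.inner_single_left]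
    simp
  refine ⟨φ, hφ, hrep, ?_⟩
  let b := stdOrthonormalBasis ℂ W
  -- Evaluation at any point of `G` has the same norm `‖φ‖` on `W`, so summing over `x` gives `n‖φ‖²
  -- = dim W`.
  have hparseval (x : G) : ∑ i, ‖(b i : EuclideanSpace ℂ G) x‖ ^ 2 = ‖φ‖ ^ 2 := by
    rw [← norm_rightTranslate x⁻¹ φ]
    have := b.sum_sq_norm_inner_left ⟨_, hW.rightTranslate_mem x⁻¹ φ hφ⟩
    simp only [Submodule.coe_inner, Submodule.coe_norm] at this
    rw [← this]
    exact Finset.sum_congr rfl fun i _ => by rw [hrep x _ (b i).2]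
  have hone (i) : ∑ x : G, ‖(b i : EuclideanSpace ℂ G) x‖ ^ 2 = 1 := by
    rw [← EuclideanSpace.norm_sq_eq, ← Submodule.coe_norm, b.orthonormal.1 i, one_pow]
  have h1 : ∑ x : G, ∑ i, ‖(b i : EuclideanSpace ℂ G) x‖ ^ 2 = Module.finrank ℂ W := by
    rw [Finset.sum_comm]
    simp [hone]
  simp only [hparseval, Finset.sum_const, Finset.card_univ, nsmul_eq_mul] at h1
  rw [eq_div_iff hn.ne', mul_comm, h1]

/-- A real sum-zero function `u` with `|u| ≤ s` has sum at least `(∑ u²) / 2s` on the set where it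
is positive. -/
theorem sum_sq_le_two_mul_sum_pos {α : Type*} [Fintype α] {u : α → ℝ} {s : ℝ}
    (hu : ∀ x, |u x| ≤ s) (h0 : ∑ x, u x = 0) :
    ∑ x, u x ^ 2 ≤ 2 * s * ∑ x with 0 < u x, u x := by
  -- The positive and negative parts have equal sums because the total is zero.
  have h1 : ∑ x, |u x| = 2 * ∑ x with 0 < u x, u x := by
    have : ∑ x, |u x| = ∑ x, (|u x| + u x) := by
      rw [Finset.sum_add_distrib, h0, add_zero]
    rw [this, Finset.sum_filter, Finset.mul_sum]
    refine Finset.sum_congr rfl fun x _ => ?_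
    split_ifs with hx
    · rw [abs_of_pos hx]
      ring
    · rw [abs_of_nonpos (not_lt.1 hx)]
      ring
  calc ∑ x, u x ^ 2 ≤ ∑ x, s * |u x| := by
        refine Finset.sum_le_sum fun x _ => ?_
        rw [← sq_abs, sq]
        exact mul_le_mul_of_nonneg_right (hu x) (abs_nonneg _)
    _ = 2 * s * ∑ x with 0 < u x, u x := by
        rw [← Finset.mul_sum, h1]
        ring

/-- A complex sum-zero function `φ` with `|φ| ≤ s` has a large sum over some set. -/
theorem exists_le_norm_sum {α : Type*} [Fintype α] {φ : α → ℂ} {s : ℝ}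
    (hφ : ∀ x, ‖φ x‖ ≤ s) (h0 : ∑ x, φ x = 0) :
    ∃ A : Finset α, ∑ x, ‖φ x‖ ^ 2 ≤ 4 * s * ‖∑ x ∈ A, φ x‖ := by
  rcases isEmpty_or_nonempty α with hα | ⟨⟨x₀⟩⟩
  · exact ⟨∅, by simp⟩
  have hs : 0 ≤ s := (norm_nonneg _).trans (hφ x₀)
  have hre := sum_sq_le_two_mul_sum_pos (u := fun x => (φ x).re)
    (fun x => (Complex.abs_re_le_norm _).trans (hφ x)) (by rw [← Complex.re_sum, h0]; rfl)
  have him := sum_sq_le_two_mul_sum_pos (u := fun x => (φ x).im)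
    (fun x => (Complex.abs_im_le_norm _).trans (hφ x)) (by rw [← Complex.im_sum, h0]; rfl)
  have hsum : ∑ x, ‖φ x‖ ^ 2 = ∑ x, (φ x).re ^ 2 + ∑ x, (φ x).im ^ 2 := by
    rw [← Finset.sum_add_distrib]
    refine Finset.sum_congr rfl fun x _ => ?_
    rw [Complex.sq_norm, Complex.normSq_apply]
    ring
  -- The larger of the real and imaginary parts carries at least half of `∑ |φ|²`; this second
  -- factor of two produces the constant `4`.
  rcases le_total (∑ x, (φ x).re ^ 2) (∑ x, (φ x).im ^ 2) with h | h
  · refine ⟨Finset.univ.filter fun x => 0 < (φ x).im, ?_⟩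
    have h1 := (le_abs_self _).trans
      (Complex.abs_im_le_norm (∑ x with 0 < (φ x).im, φ x))
    rw [Complex.im_sum] at h1
    nlinarith [mul_le_mul_of_nonneg_left h1 hs]
  · refine ⟨Finset.univ.filter fun x => 0 < (φ x).re, ?_⟩
    have h1 := (le_abs_self _).trans
      (Complex.abs_re_le_norm (∑ x with 0 < (φ x).re, φ x))
    rw [Complex.re_sum] at h1
    nlinarith [mul_le_mul_of_nonneg_left h1 hs]

/-- The value `φ x` is the inner product of a translate of `φ` with `φ`, so Cauchy–Schwarz applies.
-/
theorem norm_apply_le_of_reproducing {W : Submodule ℂ (EuclideanSpace ℂ G)}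
    {φ : EuclideanSpace ℂ G} (hφ : φ ∈ W)
    (hrep : ∀ (x : G), ∀ w ∈ W, inner ℂ (rightTranslate x⁻¹ φ) w = w x) (x : G) :
    ‖φ x‖ ≤ ‖φ‖ ^ 2 := by
  rw [← hrep x φ hφ, sq]
  exact (norm_inner_le_norm _ _).trans_eq (by rw [norm_rightTranslate])

/-- A quasirandom function correlates little with a reproducing kernel. -/
theorem norm_sum_mul_reproducing_le {W : Submodule ℂ (EuclideanSpace ℂ G)}
    (hW : IsSumZeroInvariant W) {φ : EuclideanSpace ℂ G} (hφ : φ ∈ W)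
    (hrep : ∀ (x : G), ∀ w ∈ W, inner ℂ (rightTranslate x⁻¹ φ) w = w x)
    {f : G → ℂ} {c : ℝ} (hf : IsQuasirandomFun f c) :
    ‖∑ x : G, f x * φ x‖ ^ 4 ≤ c * (Fintype.card G : ℝ) ^ 4 * ‖φ‖ ^ 8 := by
  let v : EuclideanSpace ℂ G := ∑ x : G, (starRingEnd ℂ) (f x) • rightTranslate x⁻¹ φ
  have h1 : ∑ x : G, f x * φ x = inner ℂ v φ := by
    simp only [v, sum_inner, inner_smul_left, Complex.conj_conj, hrep _ φ hφ]
  let a (z : G) : ℝ := ‖∑ x : G, f x * (starRingEnd ℂ) (f (z * x))‖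
  -- Inner products of translates of `φ` are again values of `φ`, so `‖v‖²` is the autocorrelation
  -- of `f` weighted by `φ`.
  have h2 : inner ℂ v v = ∑ z : G, φ z⁻¹ * ∑ x : G, (starRingEnd ℂ) (f (z * x)) * f x := by
    have hkk (x y : G) : inner ℂ (rightTranslate x⁻¹ φ) (rightTranslate y⁻¹ φ) =
        φ (x * y⁻¹) := hrep x _ (hW.rightTranslate_mem _ _ hφ)
    simp only [v, sum_inner, inner_sum, inner_smul_left, inner_smul_right, hkk,
      Complex.conj_conj, Finset.mul_sum]
    rw [Finset.sum_comm, Finset.sum_comm (s := Finset.univ (α := G)) (f := fun z x => φ z⁻¹ * _)]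
    refine Finset.sum_congr rfl fun x _ => ?_
    refine Fintype.sum_equiv (Equiv.mulRight x⁻¹) _ _ fun y => ?_
    simp
    ring
  have h3 : ‖v‖ ^ 2 ≤ ‖φ‖ ^ 2 * ∑ z : G, a z := by
    have : ‖v‖ ^ 2 = ‖(inner ℂ v v : ℂ)‖ := by
      rw [inner_self_eq_norm_sq_to_K]
      simp
    rw [this, h2, Finset.mul_sum]
    refine (norm_sum_le _ _).trans (Finset.sum_le_sum fun z _ => ?_)
    rw [norm_mul]
    simp only [a, mul_comm (f _)]
    gcongr
    exact norm_apply_le_of_reproducing hφ hrep _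
  have h4 : (∑ z : G, a z) ^ 2 ≤ c * (Fintype.card G : ℝ) ^ 4 := by
    calc (∑ z : G, a z) ^ 2 ≤ Fintype.card G * ∑ z : G, a z ^ 2 := by
          simpa using sq_sum_le_card_mul_sum_sq (s := Finset.univ) (f := a)
      _ ≤ Fintype.card G * (c * (Fintype.card G : ℝ) ^ 3) := by
          gcongr
          exact hf
      _ = _ := by ring
  calc ‖∑ x : G, f x * φ x‖ ^ 4 ≤ (‖v‖ * ‖φ‖) ^ 4 := by
        rw [h1]
        gcongr
        exact norm_inner_le_norm _ _
    _ = (‖v‖ ^ 2) ^ 2 * ‖φ‖ ^ 4 := by ring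
    _ ≤ (‖φ‖ ^ 2 * ∑ z : G, a z) ^ 2 * ‖φ‖ ^ 4 := by gcongr
    _ = (∑ z : G, a z) ^ 2 * ‖φ‖ ^ 8 := by ring
    _ ≤ _ := by gcongr

theorem sum_balancedFn_mul {G : Type*} [Fintype G] (A : Finset G) {h : G → ℂ} (h0 : ∑ x : G, h x = 0) :
    ∑ x : G, balancedFn A x * h x = ∑ x ∈ A, h x := by
  classical
  simp only [balancedFn, sub_mul, Finset.sum_sub_distrib, ← Finset.mul_sum, h0, mul_zero, sub_zero]
  simp [charFn, Set.indicator_apply]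

end ReproducingKernel

/-! ### Balanced functions in convolutions; autocorrelation as `f * f^*`. -/

section Convolution

variable {G : Type*} [Group G] [Fintype G]

theorem sum_norm_sq_balancedFn_le (A : Finset G) :
    ∑ x : G, ‖balancedFn A x‖ ^ 2 ≤ A.card := by
  classical
  have hn := card_pos_real (G := G)
  set p : ℝ := (A.card : ℝ) / Fintype.card G with hp
  have hb (x : G) : ‖balancedFn A x‖ ^ 2 = (1 - 2 * p) * (if x ∈ A then 1 else 0) + p ^ 2 := by
    rw [balancedFn_eq_ofReal, ← hp, Complex.norm_real, Real.norm_eq_abs, sq_abs]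
    split_ifs <;> ring
  have hpn : p * Fintype.card G = A.card := div_mul_cancel₀ _ hn.ne'
  have hp0 : 0 ≤ p := by positivity
  simp only [hb, Finset.sum_add_distrib, ← Finset.mul_sum, Finset.sum_const, Finset.card_univ,
    nsmul_eq_mul]
  simp only [Finset.sum_ite_mem, Finset.univ_inter, Finset.sum_const, nsmul_eq_mul, mul_one]
  rw [← hpn]
  nlinarith [mul_nonneg (mul_nonneg hp0 hp0) hn.le]

/-- Convolving a constant with a sum-zero function gives zero, so `A` may be replaced by `A - p`. -/
theorem groupConv_balancedFn (A : Finset G) {h : G → ℂ} (h0 : ∑ x : G, h x = 0) :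
    groupConv (balancedFn A) h = groupConv (charFn A) h := by
  ext y
  have : ∑ u : G, h (u⁻¹ * y) = 0 := by
    rw [← h0]
    exact Fintype.sum_equiv ((Equiv.inv G).trans (Equiv.mulRight y)) _ _ fun _ => rfl
  simp only [groupConv, balancedFn, sub_mul, Finset.sum_sub_distrib, ← Finset.mul_sum, this,
    mul_zero, sub_zero]

theorem l2norm_sq {G : Type*} [Fintype G] (f : G → ℂ) : l2norm f ^ 2 = ∑ x : G, ‖f x‖ ^ 2 :=
  EuclideanSpace.norm_sq_eq _

theorem l2norm_adjointFn_sq (f : G → ℂ) :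
    l2norm (adjointFn f) ^ 2 = ∑ x : G, ‖f x‖ ^ 2 := by
  rw [l2norm_sq]
  exact Fintype.sum_equiv (Equiv.inv G) _ _ fun x => by simp [adjointFn]

theorem isQuasirandomFun_iff_groupConv (f : G → ℂ) (c : ℝ) :
    IsQuasirandomFun f c ↔
      l2norm (groupConv f (adjointFn f)) ^ 2 ≤ c * (Fintype.card G : ℝ) ^ 3 := by
  unfold IsQuasirandomFun
  rw [l2norm_sq, Fintype.sum_equiv (Equiv.inv G)]
  intro y
  simp [groupConv, adjointFn]

end Convolution

/-! ### Implications with explicit constants. -/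

section Implications

variable {G : Type u} [Group G] [Fintype G] {c : ℝ}

theorem functionsQuasirandom_iff_productFunctionsQuasirandom :
    FunctionsQuasirandom G c ↔ ProductFunctionsQuasirandom G c := by
  simp only [FunctionsQuasirandom, ProductFunctionsQuasirandom, isQuasirandomFun_iff_prod]

theorem norm_balancedFn_le (A : Finset G) (x : G) : ‖balancedFn A x‖ ≤ 1 := by
  classical
  have hn := card_pos_real (G := G)
  set p : ℝ := (A.card : ℝ) / Fintype.card G with hp
  have hp0 : 0 ≤ p := by positivity
  have hp1 : p ≤ 1 := (div_le_one hn).2 (Nat.cast_le.2 A.card_le_univ)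
  rw [balancedFn_eq_ofReal, ← hp, Complex.norm_real, Real.norm_eq_abs, abs_le]
  split_ifs <;> constructor <;> linarith

theorem FunctionsQuasirandom.cayleyQuasirandom (h : FunctionsQuasirandom G c) :
    CayleyQuasirandom G c := fun A =>
  (isQuasirandomBipGraph_cayleyAdj_iff A c).2
    (h _ (norm_balancedFn_le A) (sum_balancedFn A))

/-- With `f = A - p`, the autocorrelation norm is that of `f * f^* = A * f^*`, to which the
convolution bound applies directly; `|A| ≤ n` finishes. -/
theorem ConvolutionBound.cayleyQuasirandom (h : ConvolutionBound G c) :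
    CayleyQuasirandom G (c ^ 2) := fun A => by
  have h0 := sum_adjointFn (sum_balancedFn A)
  rw [isQuasirandomBipGraph_cayleyAdj_iff, isQuasirandomFun_iff_groupConv,
    groupConv_balancedFn A h0]
  have hA : (A.card : ℝ) ≤ Fintype.card G := Nat.cast_le.2 A.card_le_univ
  calc l2norm (groupConv (charFn A) (adjointFn (balancedFn A))) ^ 2
      ≤ (c * Real.sqrt (Fintype.card G) * Real.sqrt A.card *
          l2norm (adjointFn (balancedFn A))) ^ 2 :=
        pow_le_pow_left₀ (norm_nonneg _) (h A _ h0) 2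
    _ = c ^ 2 * Fintype.card G * A.card * ∑ x : G, ‖balancedFn A x‖ ^ 2 := by
        rw [mul_pow, mul_pow, mul_pow, Real.sq_sqrt (Nat.cast_nonneg _),
          Real.sq_sqrt (Nat.cast_nonneg _), l2norm_adjointFn_sq]
    _ ≤ c ^ 2 * Fintype.card G * Fintype.card G * Fintype.card G := by
        gcongr
        exact (sum_norm_sq_balancedFn_le A).trans hA
    _ = _ := by ring

theorem RepresentationsLarge.convolutionBound (hc : 0 < c) (h : RepresentationsLarge G c) :
    ConvolutionBound G (Real.sqrt c) := fun A f hf => by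
  have h1 := norm_sq_convMap_le hc ((representationsLarge_iff G c).1 h) (sum_balancedFn A)
    (WithLp.toLp 2 f)
  have h2 : ‖convMap (balancedFn A) (WithLp.toLp 2 f)‖ = l2norm (groupConv (charFn A) f) := by
    rw [← groupConv_balancedFn A hf]
    rfl
  rw [h2] at h1
  refine le_of_sq_le_sq (h1.trans ?_) (mul_nonneg (by positivity) (norm_nonneg _))
  rw [mul_pow, mul_pow, mul_pow, Real.sq_sqrt hc.le, Real.sq_sqrt (Nat.cast_nonneg _),
    Real.sq_sqrt (Nat.cast_nonneg _)]
  unfold l2norm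
  gcongr
  exact sum_norm_sq_balancedFn_le A

theorem RepresentationsLarge.functionsQuasirandom (hc : 0 < c) (h : RepresentationsLarge G c) :
    FunctionsQuasirandom G c := fun f hf1 hf0 => by
  have h1 := norm_sq_convMap_le hc ((representationsLarge_iff G c).1 h) hf0
    (WithLp.toLp 2 (adjointFn f))
  have hn : ∑ x : G, ‖f x‖ ^ 2 ≤ Fintype.card G := by
    calc ∑ x : G, ‖f x‖ ^ 2 ≤ ∑ _x : G, (1 : ℝ) :=
          Finset.sum_le_sum fun x _ => pow_le_one₀ (norm_nonneg _) (hf1 x)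
      _ = Fintype.card G := by simp
  rw [isQuasirandomFun_iff_groupConv]
  calc l2norm (groupConv f (adjointFn f)) ^ 2
      ≤ c * Fintype.card G * (∑ x : G, ‖f x‖ ^ 2) * l2norm (adjointFn f) ^ 2 := h1
    _ = c * Fintype.card G * (∑ x : G, ‖f x‖ ^ 2) * ∑ x : G, ‖f x‖ ^ 2 := by
        rw [l2norm_adjointFn_sq]
    _ ≤ c * Fintype.card G * Fintype.card G * Fintype.card G := by gcongr
    _ = _ := by ring

theorem CayleyQuasirandom.representationsLarge (hc : 0 < c) (h : CayleyQuasirandom G c) :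
    RepresentationsLarge G (4 * c ^ (1 / 4 : ℝ)) := by
  rw [representationsLarge_iff]
  intro W hW hne
  have hn := card_pos_real (G := G)
  have hk : 0 < (Module.finrank ℂ W : ℝ) := by
    have := Submodule.nontrivial_iff_ne_bot.2 hne
    exact Nat.cast_pos.2 Module.finrank_pos
  obtain ⟨φ, hφ, hrep, hnorm⟩ := exists_reproducingKernel hW
  have hpos : 0 < ‖φ‖ ^ 2 := by
    rw [hnorm]
    positivity
  have h0 := hW.sum_eq_zero φ hφ
  obtain ⟨A, hA⟩ := exists_le_norm_sum (norm_apply_le_of_reproducing hφ hrep) h0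
  rw [← EuclideanSpace.norm_sq_eq] at hA
  -- The pointwise bound `s = ‖φ‖²` equals the left side of `hA`, so it cancels and the lower bound
  -- is an absolute constant.
  have hlow : 1 ≤ 4 * ‖∑ x ∈ A, φ x‖ := by
    refine le_of_mul_le_mul_left ?_ hpos
    linarith
  have hup := norm_sum_mul_reproducing_le hW hφ hrep
    ((isQuasirandomBipGraph_cayleyAdj_iff A c).1 (h A))
  rw [sum_balancedFn_mul A h0] at hup
  have hc4 : (c ^ (1 / 4 : ℝ)) ^ 4 = c := by
    rw [← Real.rpow_natCast, ← Real.rpow_mul hc.le]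
    norm_num
  have hroot : 0 < c ^ (1 / 4 : ℝ) := Real.rpow_pos_of_pos hc _
  -- Since `‖φ‖⁸ = (k/n)⁴`, the factor `n⁴` cancels and a fourth root is taken.
  have hfin : ‖∑ x ∈ A, φ x‖ ≤ c ^ (1 / 4 : ℝ) * Module.finrank ℂ W := by
    refine le_of_pow_le_pow_left₀ (n := 4) (by norm_num) (by positivity) (hup.trans_eq ?_)
    rw [mul_pow, hc4, show ‖φ‖ ^ 8 = (‖φ‖ ^ 2) ^ 4 by ring, hnorm]
    field_simp
  rw [inv_le_iff_one_le_mul₀ (by positivity)]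
  linarith

end Implications

/-! ### Composition of polynomial implications and the final assembly. -/

theorem PolyImplies.trans {P Q R : GroupProperty.{u}} (h : PolyImplies P Q)
    (h' : PolyImplies Q R) : PolyImplies P R := by
  obtain ⟨K, δ, hK, hδ, h⟩ := h
  obtain ⟨K', δ', hK', hδ', h'⟩ := h'
  refine ⟨K' * K ^ δ', δ * δ', by positivity, by positivity, fun G _ _ c hc hP => ?_⟩
  have := h' G _ (by positivity) (h G c hc hP)
  rwa [Real.mul_rpow hK.le (by positivity), ← Real.rpow_mul hc.le, ← mul_assoc] at this

theorem polyImplies_of_same {P Q : GroupProperty.{u}}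
    (h : ∀ (G : Type u) [Group G] [Fintype G] (c : ℝ), 0 < c → P G c → Q G c) :
    PolyImplies P Q :=
  ⟨1, 1, one_pos, one_pos, fun G _ _ c hc hP => by simpa using h G c hc hP⟩

/-- The five properties are polynomially equivalent, and the third and the fourth are equivalent
with the same constant. -/
theorem theorem4p5 :
    (∀ P ∈ ({@CayleyQuasirandom.{u}, @ConvolutionBound.{u}, @FunctionsQuasirandom.{u},
          @ProductFunctionsQuasirandom.{u}, @RepresentationsLarge.{u}} : Set GroupProperty.{u}),
      ∀ Q ∈ ({@CayleyQuasirandom.{u}, @ConvolutionBound.{u}, @FunctionsQuasirandom.{u},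
          @ProductFunctionsQuasirandom.{u}, @RepresentationsLarge.{u}} : Set GroupProperty.{u}),
        PolyImplies P Q) ∧
    (∀ (G : Type u) [Group G] [Fintype G] (c : ℝ),
      FunctionsQuasirandom G c ↔ ProductFunctionsQuasirandom G c) := by
  have hCR : PolyImplies @CayleyQuasirandom.{u} @RepresentationsLarge.{u} :=
    ⟨4, 1 / 4, by norm_num, by norm_num, fun G _ _ c hc h => h.representationsLarge hc⟩
  have hFC : PolyImplies @FunctionsQuasirandom.{u} @CayleyQuasirandom.{u} :=
    polyImplies_of_same fun G _ _ c _ h => h.cayleyQuasirandom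
  have hBC : PolyImplies @ConvolutionBound.{u} @CayleyQuasirandom.{u} :=
    ⟨1, 2, one_pos, two_pos, fun G _ _ c _ h => by simpa using h.cayleyQuasirandom⟩
  have hFP : PolyImplies @FunctionsQuasirandom.{u} @ProductFunctionsQuasirandom.{u} :=
    polyImplies_of_same fun G _ _ c _ h =>
      functionsQuasirandom_iff_productFunctionsQuasirandom.1 h
  have hPF : PolyImplies @ProductFunctionsQuasirandom.{u} @FunctionsQuasirandom.{u} :=
    polyImplies_of_same fun G _ _ c _ h =>
      functionsQuasirandom_iff_productFunctionsQuasirandom.2 h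
  have hRF : PolyImplies @RepresentationsLarge.{u} @FunctionsQuasirandom.{u} :=
    polyImplies_of_same fun G _ _ c hc h => h.functionsQuasirandom hc
  have hRB : PolyImplies @RepresentationsLarge.{u} @ConvolutionBound.{u} :=
    ⟨1, 1 / 2, one_pos, by norm_num, fun G _ _ c hc h => by
      simpa [Real.sqrt_eq_rpow] using h.convolutionBound hc⟩
  have hRR : PolyImplies @RepresentationsLarge.{u} @RepresentationsLarge.{u} :=
    polyImplies_of_same fun G _ _ c _ h => h
  refine ⟨fun P hP Q hQ => PolyImplies.trans (Q := @RepresentationsLarge.{u}) ?_ ?_,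
    fun G _ _ c => functionsQuasirandom_iff_productFunctionsQuasirandom⟩
  · rcases hP with rfl | rfl | rfl | rfl | rfl
    · exact hCR
    · exact hBC.trans hCR
    · exact hFC.trans hCR
    · exact (hPF.trans hFC).trans hCR
    · exact hRR
  · rcases hQ with rfl | rfl | rfl | rfl | rfl
    · exact hRF.trans hFC
    · exact hRB
    · exact hRF
    · exact hRF.trans hFP
    · exact hRR
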